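/- Let $\Omega\subset\mathbb R^k$ be compact and let $\mathcal P_1(\Omega)$ be the set of Borel probability measures on $\Omega$, with the Wasserstein distances $W_p$ ($p>1$) for the cost $|x-y|^p$. For a signed measure $\nu$ with Jordan decomposition $\nu=\nu_+-\nu_-$ put $\|\nu\|_{TV}=\nu_+(\Omega)+\nu_-(\Omega)$. Let $d>0$, $L,K>0$ and $N\ge 2$ an integer. A measure $\mu\in\mathcal P_1(\Omega)$ is called strongly $d$-connected with constants $L,K,N$ if there is a probability space $(D,\beta)$ such that for all $x_0,x_1\in\operatorname{supp}\mu$ there are points $y_1=x_0,y_2,\dots,y_n=x_1$ in $\operatorname{supp}\mu$, $1\le n\le N$, and measurable maps $\Phi_j:[0,1]\times D\to\operatorname{supp}\mu$, $1\le j\le n-1$, with the following properties: (i) $s\mapsto\Phi_j(s,b)$ is $L$-Lipschitz for every $b\in D$; (ii) $\Phi_j$ is injective on $(0,1)\times D$, and $\Phi_j(0,b)=y_j$, $\Phi_j(1,b)=y_{j+1}$ for every $b\in D$; (iii) $(\Phi_j)_\#\rho\le\mu$, where $\rho(ds,db)=K s^{d-1}(1-s)^{d-1}\,ds\,\beta(db)$.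 Let $I\subset\mathbb R$ be an interval, $1<r\le\infty$, and let $t\mapsto\mu_{(t)}\in\mathcal P_1(\Omega)$, $t\in I$, be a curve for which there is a non-negative $m\in L^r(I)$ with $\|\mu_{(t)}-\mu_{(\tau)}\|_{TV}\le\int_\tau^t m(s)\,ds$ for all $\tau<t$ in $I$. Assume that $\operatorname{supp}\mu_{(t)}\subseteq\operatorname{supp}\mu_{(\tau)}$ for all $\tau<t$ in $I$, and that there are constants $L,K,N$ independent of $t$ such that every $\mu_{(t)}$, $t\in I$, is strongly $d$-connected with constants $L,K,N$. Then for every $p>1$ with $p/(p-1)\ne d$ there is a constant $C$ such that, with $q=\min(1,1/d+1/p)$, $$W_p(\mu_{(t)},\mu_{(\tau)})\le C\,|t-\tau|^{q(r-1)/r}\qquad\text{for all }t,\tau\in I,$$ where $(r-1)/r$ is read as $1$ if $r=\infty$. If $r=\infty$ and $p>1$ satisfies $p/(p-1)=d$, then there is a constant $C$ such that $$W_p(\mu_{(t)},\mu_{(\tau)})\le C\,|t-\tau|\left[\left(\ln^+\frac1{|t-\tau|}\right)^{1/p}+1\right]\qquad\text{for all }t\ne\tau\text{ in }I,$$ where $\ln^+x=\max(0,\ln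 x)$. -/

import Mathlib

open MeasureTheory
open scoped ENNReal NNReal

universe v

/-- The `p`-Wasserstein distance of two Borel probability measures, with values in `[0, ∞]`:
the `p`-th root of the infimum of the `p`-cost over all couplings. -/
noncomputable def wasserstein {X : Type*} [PseudoEMetricSpace X] [MeasurableSpace X]
    (p : ℝ) (μ ν : ProbabilityMeasure X) : ℝ≥0∞ :=
  (⨅ π ∈ {π : Measure (X × X) | π.map Prod.fst = (μ : Measure X) ∧ π.map Prod.snd = (ν : Measure X)},
    ∫⁻ z, edist z.1 z.2 ^ p ∂π) ^ (1 / p)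

/-- The total variation norm `‖μ - ν‖ = (μ - ν)₊(X) + (μ - ν)₋(X)`. -/
noncomputable def tvDist {X : Type*} [MeasurableSpace X] (μ ν : ProbabilityMeasure X) : ℝ :=
  (((μ : Measure X).toSignedMeasure - (ν : Measure X).toSignedMeasure).totalVariation
    Set.univ).toReal

/-- The support of a probability measure. -/
def supp {X : Type*} [TopologicalSpace X] [MeasurableSpace X] (μ : ProbabilityMeasure X) : Set X :=
  (μ : Measure X).support

/-- Membership of a curve of probability measures in `AC^r(I; TV)`. -/
def IsACTV {X : Type*} [MeasurableSpace X] (I : Set ℝ) (r : ℝ≥0∞)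
    (μ : I → ProbabilityMeasure X) : Prop :=
  ∃ m : ℝ → ℝ, (∀ s, 0 ≤ m s) ∧ MemLp m r (volume.restrict I) ∧
    ∀ τ t : I, τ < t → tvDist (μ t) (μ τ) ≤ ∫ s in (τ : ℝ)..t, m s

/-- The measure `K s^(d-1) (1-s)^(d-1) ds dβ` on `[0,1] × D`. -/
noncomputable def tubeMeasure {D : Type*} [MeasurableSpace D] (d K : ℝ) (β : Measure D) :
    Measure (unitInterval × D) :=
  ((volume : Measure unitInterval).prod β).withDensity fun z =>
    ENNReal.ofReal (K * (z.1 : ℝ) ^ (d - 1) * (1 - (z.1 : ℝ)) ^ (d - 1))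

/-- `Φ : [0,1] × D → supp μ` is an admissible tube from `y` to `y'`. -/
structure IsTube {X : Type*} [PseudoMetricSpace X] [MeasurableSpace X] {D : Type*}
    [MeasurableSpace D] (d : ℝ) (L : ℝ≥0) (K : ℝ) (β : Measure D) (μ : ProbabilityMeasure X)
    (y y' : X) (Φ : unitInterval × D → X) : Prop where
  measurable : Measurable Φ
  mem_supp : ∀ z, Φ z ∈ supp μ
  lipschitz : ∀ b, LipschitzWith L fun s => Φ (s, b)
  injOn : Set.InjOn Φ {z | 0 < z.1 ∧ z.1 < 1}
  source : ∀ b, Φ (0, b) = y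
  target : ∀ b, Φ (1, b) = y'
  map_le : (tubeMeasure d K β).map Φ ≤ (μ : Measure X)

/-- `μ` is strongly `d`-connected with constants `L`, `K`, `N`. The parameter space `(D, β)` is
normalized to have mass one (its mass is absorbed in `K`), so that `K` is a meaningful constant.
The chain `y 0, …, y n` consists of `n + 1 ≤ N` points joined by `n` tubes. -/
def StronglyConnectedWith {X : Type*} [PseudoMetricSpace X] [MeasurableSpace X]
    (d : ℝ) (L : ℝ≥0) (K : ℝ) (N : ℕ) (μ : ProbabilityMeasure X) : Prop :=
  ∃ (D : Type v) (_ : MeasurableSpace D) (β : Measure D), IsProbabilityMeasure β ∧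
    ∀ x₀ ∈ supp μ, ∀ x₁ ∈ supp μ, ∃ (n : ℕ) (y : Fin (n + 1) → X)
      (Φ : Fin n → unitInterval × D → X),
      n + 1 ≤ N ∧ y 0 = x₀ ∧ y (Fin.last n) = x₁ ∧ (∀ j, y j ∈ supp μ) ∧
        ∀ j : Fin n, IsTube d L K β μ (y j.castSucc) (y j.succ) (Φ j)

/-- All members of the family are strongly `d`-connected, with common constants `L`, `K`, `N`. -/
def UniformlyStronglyConnected {T : Type*} {X : Type*} [PseudoMetricSpace X] [MeasurableSpace X]
    (d : ℝ) (μ : T → ProbabilityMeasure X) : Prop :=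
  ∃ (L : ℝ≥0) (K : ℝ) (N : ℕ), 0 < L ∧ 0 < K ∧ 2 ≤ N ∧
    ∀ t, StronglyConnectedWith.{v} d L K N (μ t)

/-! The estimate is proved on the dual side. `DualBound p μ ν B` says that every admissible pair of
potentials has value at most `B`. Such bounds scale, add and compose, and
`DualBound.exists_coupling` turns one into a coupling of cost at most `B`, so that `W_p ≤ B ^ (1 /
p)`.

The basic move carries a point mass `e` from `x₀` to `x₁` over the background `μ`, not by sending it
all the way but by pushing the mass along each tube a little forward. In the coordinate `v = s ^ d`
the weight `s ^ (d - 1) ds` is a multiple of Lebesgue measure, and the push is the translation by a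
multiple of `e`. Back in `s` the displacement is of order `e * v ^ (1 / d - 1)`, except for the mass
that starts at the end of the tube, which moves by `e ^ (1 / d)`. The total cost is `shiftCost`, of
order `e ^ min p (1 + p / d)`. A logarithm appears exactly when `(1 / d - 1) * p = -1`, that is, `p
/ (p - 1) = d`.

For two measures of the curve, the excess `(μ - ν)₊` and the deficit `(ν - μ)₊` have equal mass, at
most `e`. Against given potentials both may be replaced by point masses at maximum points on `supp
μ`. The excess is itself part of `μ`, so the move is made only to the midpoint `(μ + ν) / 2`, which
leaves half of `μ` as background (`dualBound_midpoint`). The other half of the way is absorbed by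
convexity (`DualBound.of_midpoint`). Hölder's inequality gives `e` of order `|t - τ| ^ (1 - 1 / r)`.
-/

section Inequalities

/-! ### Weighted triangle inequalities for powers of the distance -/

/-- Convexity of `x ↦ x ^ p` in the form of a weighted triangle inequality. -/
lemma add_rpow_le_weighted {p l u v : ℝ} (hp : 1 ≤ p) (hl : 0 < l) (hl1 : l < 1) (hu : 0 ≤ u)
    (hv : 0 ≤ v) : (u + v) ^ p ≤ l ^ (1 - p) * u ^ p + (1 - l) ^ (1 - p) * v ^ p := by
  have hl' : 0 < 1 - l := by linarith
  have h := (convexOn_rpow hp).2 (show u / l ∈ Set.Ici 0 from div_nonneg hu hl.le)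
    (show v / (1 - l) ∈ Set.Ici 0 from div_nonneg hv hl'.le) hl.le hl'.le (by ring)
  simp only [smul_eq_mul] at h
  rw [mul_div_cancel₀ _ hl.ne', mul_div_cancel₀ _ hl'.ne', Real.div_rpow hu hl.le,
    Real.div_rpow hv hl'.le] at h
  rw [Real.rpow_sub hl, Real.rpow_sub hl', Real.rpow_one, Real.rpow_one]
  refine h.trans_eq ?_
  ring

/-- The weight `l` solves `(1 - l) ^ (1 - p) = 3 / 2`. Any coefficient below `2` would serve:
halved, it must stay below `1` for the absorption in `DualBound.of_midpoint`. -/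
lemma exists_dist_rpow_le (X : Type*) [PseudoMetricSpace X] {p : ℝ} (hp : 1 < p) :
    ∃ A : ℝ, 0 < A ∧ ∀ x y z : X, dist x y ^ p ≤ A * dist x z ^ p + 3 / 2 * dist z y ^ p := by
  set l : ℝ := 1 - (3 / 2 : ℝ) ^ (1 / (1 - p)) with hl
  have h1p : 1 - p < 0 := by linarith
  have h1 : (3 / 2 : ℝ) ^ (1 / (1 - p)) < 1 :=
    Real.rpow_lt_one_of_one_lt_of_neg (by norm_num) (one_div_neg.2 h1p)
  have h0 : 0 < (3 / 2 : ℝ) ^ (1 / (1 - p)) := by positivity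
  have hl0 : 0 < l := by linarith
  refine ⟨l ^ (1 - p), by positivity, fun x y z => ?_⟩
  have h := add_rpow_le_weighted hp.le hl0 (by linarith) (dist_nonneg (x := x) (y := z))
    (dist_nonneg (x := z) (y := y))
  have h2 : (1 - l) ^ (1 - p) = 3 / 2 := by
    rw [hl, sub_sub_cancel, ← Real.rpow_mul (by norm_num), one_div_mul_cancel h1p.ne, Real.rpow_one]
  rw [h2] at h
  exact (Real.rpow_le_rpow dist_nonneg (dist_triangle x z y) (by linarith)).trans h

lemma dist_rpow_le_two {X : Type*} [PseudoMetricSpace X] {p : ℝ} (hp : 1 < p) (x y z : X) :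
    dist x y ^ p ≤ 2 ^ (p - 1) * dist x z ^ p + 2 ^ (p - 1) * dist z y ^ p := by
  have h := add_rpow_le_weighted hp.le (l := 1 / 2) (by norm_num) (by norm_num)
    (dist_nonneg (x := x) (y := z)) (dist_nonneg (x := z) (y := y))
  have h2 : (1 / 2 : ℝ) ^ (1 - p) = 2 ^ (p - 1) := by
    rw [one_div, Real.inv_rpow (by norm_num), ← Real.rpow_neg (by norm_num), neg_sub]
  norm_num only [h2, show (1 : ℝ) - 1 / 2 = 1 / 2 by norm_num] at h
  refine (Real.rpow_le_rpow dist_nonneg (dist_triangle x z y) (by linarith)).trans ?_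
  simpa [h2] using h

end Inequalities

/-! ### Calculus of dual bounds -/

section Dual

variable {X : Type*} [PseudoMetricSpace X] [MeasurableSpace X]

/-- `B` bounds the dual Kantorovich problem for the cost `dist x y ^ p`. -/
def DualBound (p : ℝ) (μ ν : Measure X) (B : ℝ) : Prop :=
  ∀ φ ψ : C(X, ℝ), (∀ x y, φ x + ψ y ≤ dist x y ^ p) → ∫ x, φ x ∂μ + ∫ x, ψ x ∂ν ≤ B

variable {p A B C : ℝ} {μ ν ρ σ : Measure X}

namespace DualBound

lemma mono (h : DualBound p μ ν B) (hBC : B ≤ C) : DualBound p μ ν C :=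
  fun φ ψ hφψ => (h φ ψ hφψ).trans hBC

lemma nonneg (h : DualBound p μ ν B) : 0 ≤ B := by
  have := h 0 0 (fun x y => by simpa using Real.rpow_nonneg dist_nonneg p)
  simpa using this

lemma symm (h : DualBound p μ ν B) : DualBound p ν μ B := fun φ ψ hφψ => by
  rw [add_comm]
  exact h ψ φ fun x y => by rw [add_comm, dist_comm]; exact hφψ y x

lemma scaled (h : DualBound p μ ν B) (hA : 0 < A) (φ ψ : C(X, ℝ))
    (hφψ : ∀ x y, φ x + ψ y ≤ A * dist x y ^ p) :
    ∫ x, φ x ∂μ + ∫ x, ψ x ∂ν ≤ A * B := by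
  have := h (A⁻¹ • φ) (A⁻¹ • ψ) fun x y => by
    simp only [ContinuousMap.smul_apply, smul_eq_mul, ← mul_add]
    rw [inv_mul_le_iff₀ hA]
    exact hφψ x y
  simp only [ContinuousMap.smul_apply, smul_eq_mul, integral_const_mul, ← mul_add] at this
  rwa [inv_mul_le_iff₀ hA] at this

lemma smul (h : DualBound p μ ν B) {c : ℝ} (hc : 0 ≤ c) :
    DualBound p (ENNReal.ofReal c • μ) (ENNReal.ofReal c • ν) (c * B) := fun φ ψ hφψ => by
  simp only [integral_smul_measure, ENNReal.toReal_ofReal hc, smul_eq_mul, ← mul_add]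
  exact mul_le_mul_of_nonneg_left (h φ ψ hφψ) hc

end DualBound

variable [CompactSpace X]

lemma ContinuousMap.integrable_of_compact [OpensMeasurableSpace X] (f : C(X, ℝ)) (μ : Measure X)
    [IsFiniteMeasure μ] : Integrable f μ := by
  refine Integrable.of_bound f.continuous.aestronglyMeasurable ‖f‖ (.of_forall fun x => ?_)
  exact f.norm_coe_le_norm x

namespace DualBound

lemma refl [OpensMeasurableSpace X] (hp : 0 < p) (μ : Measure X) [IsFiniteMeasure μ] :
    DualBound p μ μ 0 := fun φ ψ hφψ => by
  rw [← integral_add (φ.integrable_of_compact μ) (ψ.integrable_of_compact μ)]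
  refine integral_nonpos fun x => ?_
  simpa [Real.zero_rpow hp.ne'] using hφψ x x

lemma add [OpensMeasurableSpace X] [IsFiniteMeasure μ] [IsFiniteMeasure ν] [IsFiniteMeasure ρ]
    [IsFiniteMeasure σ] (h : DualBound p μ ν B) (h' : DualBound p ρ σ C) :
    DualBound p (μ + ρ) (ν + σ) (B + C) := fun φ ψ hφψ => by
  rw [integral_add_measure (φ.integrable_of_compact μ) (φ.integrable_of_compact ρ),
    integral_add_measure (ψ.integrable_of_compact ν) (ψ.integrable_of_compact σ)]
  linarith [h φ ψ hφψ, h' φ ψ hφψ]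

/-- Enlarging the common part of two measures preserves a dual bound. -/
lemma mono_common [OpensMeasurableSpace X] {α β : Measure X} [IsFiniteMeasure α]
    [IsFiniteMeasure β] [IsFiniteMeasure σ] (hp : 0 < p) (hρ : ρ ≤ σ)
    (h : DualBound p (ρ + α) (ρ + β) B) : DualBound p (σ + α) (σ + β) B := by
  have : IsFiniteMeasure ρ := isFiniteMeasure_of_le σ hρ
  have hσ : σ = (σ - ρ) + ρ := (Measure.sub_add_cancel_of_le hρ).symm
  rw [hσ, add_assoc, add_assoc]
  simpa using (refl hp (σ - ρ)).add h

/-- An intermediate potential `χ`, the transform of `φ` for the cost `A * dist ^ p`, splits the pair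
`(φ, ψ)` into `(φ, χ)` and `(-χ, ψ)`. The integrals of `χ` against `ν` cancel. Compactness makes `χ`
continuous. -/
lemma trans_of_le [OpensMeasurableSpace X] [Nonempty X] [IsFiniteMeasure μ] [IsFiniteMeasure ν]
    [IsFiniteMeasure ρ] (hp : 0 < p) (hA : 0 < A) (hB : 0 < B) {s t : ℝ}
    (hAB : ∀ x y z : X, dist x y ^ p ≤ A * dist x z ^ p + B * dist z y ^ p)
    (h₁ : DualBound p μ ν s) (h₂ : DualBound p ν ρ t) : DualBound p μ ρ (A * s + B * t) := by
  intro φ ψ hφψ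
  have hcont : Continuous fun q : X × X => A * dist q.2 q.1 ^ p - φ q.2 := by
    have hd : Continuous fun q : X × X => dist q.2 q.1 := by fun_prop
    exact ((hd.rpow_const fun _ => Or.inr hp.le).const_mul A).sub (by fun_prop)
  let χ : C(X, ℝ) := ⟨fun z => sInf ((fun x => A * dist x z ^ p - φ x) '' Set.univ),
    isCompact_univ.continuous_sInf hcont⟩
  have hbdd (z : X) : BddBelow ((fun x => A * dist x z ^ p - φ x) '' Set.univ) :=
    (isCompact_univ.image (hcont.comp (Continuous.prodMk_right z))).bddBelow
  have hχ (x z : X) : φ x + χ z ≤ A * dist x z ^ p := by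
    have : χ z ≤ A * dist x z ^ p - φ x := csInf_le (hbdd z) ⟨x, trivial, rfl⟩
    linarith
  have hχ' (z y : X) : (-χ) z + ψ y ≤ B * dist z y ^ p := by
    have : ψ y - B * dist z y ^ p ≤ χ z := by
      refine le_csInf (Set.univ_nonempty.image _) ?_
      rintro _ ⟨x, -, rfl⟩
      simp only
      linarith [hφψ x y, hAB x y z]
    simp only [ContinuousMap.neg_apply]
    linarith
  have e₁ := h₁.scaled hA φ χ hχ
  have e₂ := h₂.scaled hB (-χ) ψ hχ'
  simp only [ContinuousMap.neg_apply, integral_neg] at e₂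
  linarith

lemma trans [OpensMeasurableSpace X] [Nonempty X] [IsFiniteMeasure μ] [IsFiniteMeasure ν]
    [IsFiniteMeasure ρ] (hp : 1 < p) {s t : ℝ}
    (h₁ : DualBound p μ ν s) (h₂ : DualBound p ν ρ t) : DualBound p μ ρ (2 ^ (p - 1) * (s + t)) :=
  (h₁.trans_of_le (by linarith) (by positivity) (by positivity) (dist_rpow_le_two hp) h₂).mono
    (by rw [mul_add])

lemma of_diam [OpensMeasurableSpace X] [IsProbabilityMeasure μ] [IsProbabilityMeasure ν]
    (hp : 0 < p) : DualBound p μ ν (Metric.diam (Set.univ : Set X) ^ p) := fun φ ψ hφψ => by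
  have hle (x y : X) : φ x + ψ y ≤ Metric.diam (Set.univ : Set X) ^ p :=
    (hφψ x y).trans (Real.rpow_le_rpow dist_nonneg
      (Metric.dist_le_diam_of_mem isCompact_univ.isBounded trivial trivial) hp.le)
  have h1 (y : X) : ∫ x, φ x ∂μ ≤ Metric.diam (Set.univ : Set X) ^ p - ψ y := by
    have := integral_mono (φ.integrable_of_compact μ)
      (integrable_const (Metric.diam (Set.univ : Set X) ^ p - ψ y))
      (fun x => by simpa using (by linarith [hle x y] : φ x ≤ _ - ψ y))
    simpa using this
  have h2 := integral_mono (ψ.integrable_of_compact ν)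
    (integrable_const (Metric.diam (Set.univ : Set X) ^ p - ∫ x, φ x ∂μ))
    (fun y => by simpa using (by linarith [h1 y] : ψ y ≤ _ - ∫ x, φ x ∂μ))
  simp only [integral_const, probReal_univ, one_smul] at h2
  linarith

/-- It suffices to reach the midpoint `(μ + ν) / 2` from `μ`: the remaining half is absorbed, since
by convexity its cost is at most half of the full cost. -/
lemma of_midpoint [OpensMeasurableSpace X] [IsProbabilityMeasure μ] [IsProbabilityMeasure ν]
    (hp : 1 < p) (hA : 0 < A)
    (hAX : ∀ x y z : X, dist x y ^ p ≤ A * dist x z ^ p + 3 / 2 * dist z y ^ p)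
    (h : DualBound p μ (ENNReal.ofReal (1 / 2) • (μ + ν)) B) : DualBound p μ ν (4 * A * B) := by
  have : Nonempty X := μ.nonempty_of_neZero
  have hp0 : 0 < p := by linarith
  let S : Set ℝ := {s | ∃ φ ψ : C(X, ℝ), (∀ x y, φ x + ψ y ≤ dist x y ^ p) ∧
    ∫ x, φ x ∂μ + ∫ x, ψ x ∂ν = s}
  -- The optimal value is finite, which is what allows a multiple of it to be absorbed below.
  have hS : BddAbove S := by
    refine ⟨Metric.diam (Set.univ : Set X) ^ p, ?_⟩
    rintro _ ⟨φ, ψ, h, rfl⟩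
    exact of_diam hp0 φ ψ h
  have hne : S.Nonempty :=
    ⟨0, 0, 0, fun x y => by simpa using Real.rpow_nonneg dist_nonneg p, by simp⟩
  have hfull : DualBound p μ ν (sSup S) := fun φ ψ hφψ => le_csSup hS ⟨φ, ψ, hφψ, rfl⟩
  -- From `(μ + ν) / 2` to `(ν + ν) / 2` one half stays put, so the cost is at most half the
  -- optimum.
  have hhalf : DualBound p (ENNReal.ofReal (1 / 2) • (μ + ν)) ν (1 / 2 * (sSup S + 0)) := by
    have h2 := (hfull.add (refl hp0 ν)).smul (c := 1 / 2) (by norm_num)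
    have e : ENNReal.ofReal (1 / 2) • (ν + ν) = ν := by
      rw [← two_smul ℝ≥0∞ ν, smul_smul, ENNReal.ofReal_div_of_pos (by norm_num)]
      simp [ENNReal.inv_mul_cancel]
    rwa [e] at h2
  have hfin : IsFiniteMeasure (ENNReal.ofReal (1 / 2) • (μ + ν)) := Measure.smul_finite _ (by simp)
  have htot := h.trans_of_le hp0 hA (by norm_num) hAX hhalf
  have : sSup S ≤ A * B + 3 / 2 * (1 / 2 * (sSup S + 0)) := by
    refine csSup_le hne ?_
    rintro _ ⟨φ, ψ, hφψ, rfl⟩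
    exact htot φ ψ hφψ
  exact hfull.mono (by linarith)

end DualBound

end Dual

/-! ### Kantorovich duality by Hahn–Banach and Riesz–Markov -/

section Duality

variable {X : Type*} [MetricSpace X] [CompactSpace X] [MeasurableSpace X] [BorelSpace X]

/-- The function `(x, y) ↦ φ x + ψ y`. -/
def ContinuousMap.oplus (φ ψ : C(X, ℝ)) : C(X × X, ℝ) :=
  ⟨fun z => φ z.1 + ψ z.2, by fun_prop⟩

/-- The cost `(x, y) ↦ dist x y ^ p`. -/
noncomputable def distRpow (X : Type*) [MetricSpace X] {p : ℝ} (hp : 0 < p) : C(X × X, ℝ) :=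
  ⟨fun z => dist z.1 z.2 ^ p, continuous_dist.rpow_const fun _ => Or.inr hp.le⟩

/-- The values `∫ φ dμ + ∫ ψ dν + t B` over all `φ`, `ψ`, `t ≥ 0` with `F ≤ φ ⊕ ψ + t c`. -/
def majorantValues {p : ℝ} (μ ν : Measure X) (B : ℝ) (F : C(X × X, ℝ)) : Set ℝ :=
  {s | ∃ (φ ψ : C(X, ℝ)) (t : ℝ), 0 ≤ t ∧ (∀ x y, F (x, y) ≤ φ x + ψ y + t * dist x y ^ p) ∧
    ∫ x, φ x ∂μ + ∫ x, ψ x ∂ν + t * B = s}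

lemma majorantValues_nonempty {X : Type*} [MetricSpace X] [CompactSpace X]
    [MeasurableSpace X] {p B : ℝ} {μ ν : Measure X} (F : C(X × X, ℝ)) :
    (majorantValues (p := p) μ ν B F).Nonempty :=
  ⟨_, ContinuousMap.const X ‖F‖, 0, 0, le_rfl, fun x y => by
    simpa using (abs_le.1 (F.norm_coe_le_norm (x, y))).2, rfl⟩

variable {p B : ℝ} {μ ν : Measure X} [IsProbabilityMeasure μ]

/-- This makes the infimum of the majorant values finite, and it is where the dual bound enters the
duality proof: if `-‖F‖ ≤ φ ⊕ ψ + t c`, then `(-φ - ‖F‖, -ψ)` is admissible for the cost `t c`. -/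
lemma DualBound.neg_norm_le (h : DualBound p μ ν B) (F : C(X × X, ℝ)) {s : ℝ}
    (hs : s ∈ majorantValues (p := p) μ ν B F) : -‖F‖ ≤ s := by
  obtain ⟨φ, ψ, t, ht, hF, rfl⟩ := hs
  have hB := h.nonneg
  -- Rescaling needs a positive factor while `t` may vanish, hence `t + e` with `e` tending to `0`.
  have key (e : ℝ) (he : 0 < e) : -‖F‖ - e * B ≤ ∫ x, φ x ∂μ + ∫ x, ψ x ∂ν + t * B := by
    have := h.scaled (A := t + e) (by linarith) (-φ - ContinuousMap.const X ‖F‖) (-ψ) fun x y => by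
      have h1 := (abs_le.1 (F.norm_coe_le_norm (x, y))).1
      have h2 := hF x y
      have h3 : 0 ≤ e * dist x y ^ p := by positivity
      simp only [ContinuousMap.sub_apply, ContinuousMap.neg_apply, ContinuousMap.const_apply]
      linarith
    simp only [ContinuousMap.sub_apply, ContinuousMap.neg_apply, ContinuousMap.const_apply] at this
    rw [integral_sub (f := fun x => -φ x) (φ.integrable_of_compact μ).neg (integrable_const _), integral_neg,
      integral_neg, integral_const, probReal_univ, one_smul] at this
    linarith
  have hlim : Filter.Tendsto (fun e : ℝ => -‖F‖ - e * B) (nhdsWithin 0 (Set.Ioi 0))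
      (nhds (-‖F‖ - 0 * B)) :=
    ((continuous_const.sub (continuous_id.mul continuous_const)).tendsto 0).mono_left
      nhdsWithin_le_nhds
  have := le_of_tendsto hlim (Filter.eventually_of_mem self_mem_nhdsWithin key)
  simpa using this

variable [IsProbabilityMeasure ν]

/-- **Kantorovich duality**, in the form of a coupling which realizes a given dual bound. -/
theorem DualBound.exists_coupling (hp : 0 < p) (h : DualBound p μ ν B) :
    ∃ π : Measure (X × X), π.map Prod.fst = μ ∧ π.map Prod.snd = ν ∧
      ∫⁻ z, edist z.1 z.2 ^ p ∂π ≤ ENNReal.ofReal B := by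
  let V := majorantValues (p := p) μ ν B
  let N : C(X × X, ℝ) → ℝ := fun F => sInf (V F)
  have hbdd (F) : BddBelow (V F) := ⟨-‖F‖, fun s hs => h.neg_norm_le F hs⟩
  have hne (F) : (V F).Nonempty := majorantValues_nonempty F
  have hNle {F : C(X × X, ℝ)} (φ ψ : C(X, ℝ)) (t : ℝ) (ht : 0 ≤ t)
      (hF : ∀ x y, F (x, y) ≤ φ x + ψ y + t * dist x y ^ p) :
      N F ≤ ∫ x, φ x ∂μ + ∫ x, ψ x ∂ν + t * B := csInf_le (hbdd F) ⟨φ, ψ, t, ht, hF, rfl⟩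
  have hsmul_le (c : ℝ) (hc : 0 < c) (F) : N (c • F) ≤ c * N F := by
    rw [← inv_mul_le_iff₀ hc]
    refine le_csInf (hne F) ?_
    rintro _ ⟨φ, ψ, t, ht, hF, rfl⟩
    rw [inv_mul_le_iff₀ hc]
    refine (hNle (c • φ) (c • ψ) (c * t) (by positivity) fun x y => ?_).trans_eq ?_
    · simp only [ContinuousMap.smul_apply, smul_eq_mul]
      nlinarith [mul_le_mul_of_nonneg_left (hF x y) hc.le]
    · simp only [ContinuousMap.smul_apply, smul_eq_mul, integral_const_mul]
      ring
  have hhom (c : ℝ) (hc : 0 < c) (F) : N (c • F) = c * N F := by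
    refine le_antisymm (hsmul_le c hc F) ?_
    have := hsmul_le c⁻¹ (inv_pos.2 hc) (c • F)
    rw [inv_smul_smul₀ hc.ne', inv_mul_eq_div, le_div_iff₀ hc] at this
    linarith
  have hadd (F G) : N (F + G) ≤ N F + N G := by
    rw [← sub_le_iff_le_add]
    refine le_csInf (hne F) ?_
    rintro _ ⟨φ, ψ, t, ht, hF, rfl⟩
    rw [sub_le_comm]
    refine le_csInf (hne G) ?_
    rintro _ ⟨φ', ψ', t', ht', hG, rfl⟩
    rw [sub_le_iff_le_add]
    refine (hNle (φ' + φ) (ψ' + ψ) (t' + t) (by positivity) fun x y => ?_).trans_eq ?_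
    · simp only [ContinuousMap.add_apply]
      linarith [hF x y, hG x y]
    · simp only [ContinuousMap.add_apply]
      rw [integral_add (φ'.integrable_of_compact μ) (φ.integrable_of_compact μ),
        integral_add (ψ'.integrable_of_compact ν) (ψ.integrable_of_compact ν)]
      ring
  -- Extending the zero functional from the zero subspace suffices: domination by `N` alone forces
  -- the marginals, the positivity and the cost bound.
  obtain ⟨g, -, hg⟩ := exists_extension_of_le_sublinear
    (⟨⊥, 0⟩ : C(X × X, ℝ) →ₗ.[ℝ] ℝ) N hhom hadd (by
      rintro ⟨x, hx⟩
      obtain rfl : x = 0 := by simpa using hx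
      have := hhom 2 (by norm_num) 0
      rw [smul_zero] at this
      have h0 : N 0 = 0 := by linarith
      simp [h0])
  have hg_oplus (φ ψ : C(X, ℝ)) : g (φ.oplus ψ) = ∫ x, φ x ∂μ + ∫ x, ψ x ∂ν := by
    refine le_antisymm ?_ ?_
    · refine (hg _).trans ((hNle φ ψ 0 le_rfl fun x y => ?_).trans_eq (by ring))
      simp [ContinuousMap.oplus]
    · have := (hg (-(φ.oplus ψ))).trans (hNle (-φ) (-ψ) 0 le_rfl fun x y => by
        simp only [ContinuousMap.oplus, ContinuousMap.neg_apply, ContinuousMap.coe_mk]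
        linarith)
      simp only [map_neg, ContinuousMap.neg_apply, integral_neg] at this
      linarith
  have hg_cost : g (distRpow X hp) ≤ B := by
    refine (hg _).trans ((hNle 0 0 1 zero_le_one fun x y => ?_).trans_eq (by simp))
    simp [distRpow]
  have hg_pos (F : C(X × X, ℝ)) (hF : 0 ≤ F) : 0 ≤ g F := by
    have := (hg (-F)).trans (hNle 0 0 0 le_rfl fun x y => by simpa using hF (x, y))
    simp only [map_neg, ContinuousMap.zero_apply, integral_zero] at this
    linarith
  let Λ : CompactlySupportedContinuousMap (X × X) ℝ →ₚ[ℝ] ℝ := PositiveLinearMap.mk₀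
    { toFun := fun F => g F.toContinuousMap
      map_add' := fun F G => by rw [← map_add]; rfl
      map_smul' := fun c F => by rw [RingHom.id_apply, ← map_smul]; rfl }
    (fun F hF => hg_pos _ hF)
  let π := RealRMK.rieszMeasure Λ
  have hπ (F : C(X × X, ℝ)) : ∫ z, F z ∂π = g F :=
    RealRMK.integral_rieszMeasure Λ (CompactlySupportedContinuousMap.continuousMapEquiv F)
  have hfin : IsFiniteMeasure π := ⟨isCompact_univ.measure_lt_top⟩
  refine ⟨π, ?_, ?_, ?_⟩
  · refine ext_of_forall_integral_eq_of_IsFiniteMeasure fun f => ?_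
    rw [integral_map measurable_fst.aemeasurable f.continuous.aestronglyMeasurable]
    have := hg_oplus f.toContinuousMap 0
    rw [← hπ] at this
    simpa [ContinuousMap.oplus] using this
  · refine ext_of_forall_integral_eq_of_IsFiniteMeasure fun f => ?_
    rw [integral_map measurable_snd.aemeasurable f.continuous.aestronglyMeasurable]
    have := hg_oplus 0 f.toContinuousMap
    rw [← hπ] at this
    simpa [ContinuousMap.oplus] using this
  · have e (z : X × X) : edist z.1 z.2 ^ p = ENNReal.ofReal (distRpow X hp z) := by
      rw [edist_dist, ENNReal.ofReal_rpow_of_nonneg dist_nonneg hp.le]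
      rfl
    simp_rw [e]
    rw [← ofReal_integral_eq_lintegral_ofReal ((distRpow X hp).integrable_of_compact π)
      (.of_forall fun z => Real.rpow_nonneg dist_nonneg p), hπ]
    exact ENNReal.ofReal_le_ofReal hg_cost

theorem DualBound.wasserstein_le {μ ν : ProbabilityMeasure X} (hp : 0 < p)
    (h : DualBound p (μ : Measure X) ν B) :
    wasserstein p μ ν ≤ ENNReal.ofReal (B ^ (1 / p)) := by
  obtain ⟨π, h₁, h₂, h₃⟩ := h.exists_coupling hp
  rw [← ENNReal.ofReal_rpow_of_nonneg h.nonneg (by positivity)]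
  exact ENNReal.rpow_le_rpow ((iInf₂_le π ⟨h₁, h₂⟩).trans h₃) (by positivity)

end Duality

/-! ### Moving a point mass across a weight on the unit interval -/

section OneDimensional

open Set

/-- The map `v ↦ v ^ a` on `[0, V]`, extended by constants to `ℝ`, with values in `[0, 1]`. -/
noncomputable def clampedPower (a V v : ℝ) : unitInterval :=
  projIcc 0 1 zero_le_one (max 0 (min v V) ^ a)

variable {a V v e p : ℝ}

lemma continuous_clampedPower (ha : 0 < a) : Continuous (clampedPower a V) :=
  continuous_projIcc.comp
    ((continuous_const.max (continuous_id.min continuous_const)).rpow_const fun _ => Or.inr ha.le)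

lemma clampedPower_of_nonpos (ha : 0 < a) (hv : v ≤ 0) : clampedPower a V v = 0 := by
  rw [clampedPower, max_eq_left (min_le_iff.2 (Or.inl hv)), Real.zero_rpow ha.ne']
  exact projIcc_left _

lemma coe_clampedPower (ha : 0 < a) (hV1 : V ≤ 1) :
    (clampedPower a V v : ℝ) = max 0 (min v V) ^ a := by
  have h0 : 0 ≤ max 0 (min v V) := le_max_left _ _
  have h1 : max 0 (min v V) ≤ 1 := max_le zero_le_one ((min_le_right _ _).trans hV1)
  rw [clampedPower, projIcc_of_mem zero_le_one ⟨by positivity, Real.rpow_le_one h0 h1 ha.le⟩]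

lemma clampedPower_of_ge (hv : V ≤ v) : clampedPower a V v = clampedPower a V V := by
  rw [clampedPower, clampedPower, min_eq_right hv, min_self]

lemma rpow_sub_rpow_sub_le (he : 0 ≤ e) (hev : e ≤ v) (hv : 0 < v) (ha : 0 < a) :
    v ^ a - (v - e) ^ a ≤ max 1 a * e * v ^ (a - 1) := by
  set x := e / v with hx
  have hx0 : 0 ≤ x := by positivity
  have hx1 : x ≤ 1 := (div_le_one hv).2 hev
  have e1 : v - e = v * (1 - x) := by rw [hx]; field_simp
  -- Bernoulli's inequality for `1 ≤ a`; for `a ≤ 1` simply `1 - x ≤ (1 - x) ^ a`.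
  have key : 1 - max 1 a * x ≤ (1 - x) ^ a := by
    rcases le_total 1 a with h | h
    · have := one_add_mul_self_le_rpow_one_add (s := -x) (by linarith) h
      rw [max_eq_right h]
      calc 1 - a * x = 1 + a * -x := by ring
        _ ≤ (1 + -x) ^ a := this
        _ = (1 - x) ^ a := by ring_nf
    · rw [max_eq_left h, one_mul]
      have := Real.rpow_le_rpow_of_exponent_ge' (by linarith : 0 ≤ 1 - x) (by linarith) ha.le h
      simpa using this
  rw [e1, Real.mul_rpow hv.le (by linarith), Real.rpow_sub hv, Real.rpow_one]
  have e2 : max 1 a * e * (v ^ a / v) = v ^ a * (max 1 a * x) := by rw [hx]; field_simp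
  rw [e2]
  nlinarith [mul_le_mul_of_nonneg_left key (Real.rpow_nonneg hv.le a)]

lemma dist_clampedPower_sub_le (ha : 0 < a) (hV : 0 ≤ V) (hV1 : V ≤ 1) (he : 0 < e) (hev : e ≤ v)
    (hvV : v ≤ V + e) :
    dist (clampedPower a V (v - e)) (clampedPower a V v) ≤ max 1 a * e * v ^ (a - 1) := by
  have hv : 0 < v := he.trans_le hev
  rw [Subtype.dist_eq, coe_clampedPower ha hV1, coe_clampedPower ha hV1,
    min_eq_left (by linarith : v - e ≤ V), max_eq_right (by linarith : 0 ≤ v - e),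
    max_eq_right (le_min hv.le hV), Real.dist_eq, abs_sub_comm, abs_of_nonneg]
  · refine le_trans (sub_le_sub_right ?_ _) (rpow_sub_rpow_sub_le he.le hev hv ha)
    exact Real.rpow_le_rpow (le_min hv.le hV) (min_le_left _ _) ha.le
  · exact sub_nonneg.2 (Real.rpow_le_rpow (by linarith) (le_min (by linarith) (by linarith)) ha.le)

lemma dist_clampedPower_zero_le (ha : 0 < a) (hV : 0 ≤ V) (hV1 : V ≤ 1) (hv : 0 ≤ v) (hve : v ≤ e) :
    dist (clampedPower a V (v - e)) (clampedPower a V v) ≤ e ^ a := by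
  rw [clampedPower_of_nonpos ha (by linarith), Subtype.dist_eq, coe_clampedPower ha hV1,
    max_eq_right (le_min hv hV), Real.dist_eq, abs_sub_comm]
  simp only [Icc.coe_zero, sub_zero]
  rw [abs_of_nonneg (Real.rpow_nonneg (le_min hv hV) _)]
  exact Real.rpow_le_rpow (le_min hv hV) ((min_le_left _ _).trans hve) ha.le

/-- The order of the cost of moving mass `e` across the density `s ^ (1 / a - 1)`. -/
noncomputable def shiftCost (p a V e : ℝ) : ℝ :=
  e ^ (1 + a * p) + e ^ p * ∫ v in e..(V + e), v ^ ((a - 1) * p)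

lemma integral_dist_clampedPower_le (ha : 0 < a) (hV : 0 ≤ V) (hV1 : V ≤ 1) (he : 0 < e)
    (hp : 0 < p) :
    ∫ v in (0 : ℝ)..(V + e), dist (clampedPower a V (v - e)) (clampedPower a V v) ^ p ≤
      max 1 a ^ p * shiftCost p a V e := by
  have hc : Continuous fun v => dist (clampedPower a V (v - e)) (clampedPower a V v) ^ p :=
    (((continuous_clampedPower ha).comp (continuous_id.sub continuous_const)).dist
      (continuous_clampedPower ha)).rpow_const fun _ => Or.inr hp.le
  have hA : 1 ≤ max 1 a ^ p := Real.one_le_rpow (le_max_left _ _) hp.le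
  rw [← intervalIntegral.integral_add_adjacent_intervals (hc.intervalIntegrable 0 e)
    (hc.intervalIntegrable e (V + e)), shiftCost, mul_add]
  refine add_le_add ?_ ?_
  · have h1 : ∫ v in (0 : ℝ)..e, dist (clampedPower a V (v - e)) (clampedPower a V v) ^ p ≤
        ∫ _ in (0 : ℝ)..e, e ^ (a * p) := by
      refine intervalIntegral.integral_mono_on he.le (hc.intervalIntegrable 0 e) (by simp) ?_
      intro v hv
      rw [Real.rpow_mul he.le]
      exact Real.rpow_le_rpow dist_nonneg (dist_clampedPower_zero_le ha hV hV1 hv.1 hv.2) hp.le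
    refine h1.trans ?_
    rw [intervalIntegral.integral_const, sub_zero, smul_eq_mul, Real.rpow_add he, Real.rpow_one]
    have : 0 ≤ e * e ^ (a * p) := by positivity
    nlinarith
  · rw [← mul_assoc, ← intervalIntegral.integral_const_mul]
    refine intervalIntegral.integral_mono_on (by linarith) (hc.intervalIntegrable _ _) ?_ ?_
    · refine (intervalIntegral.intervalIntegrable_rpow (Or.inr ?_)).const_mul _
      rw [uIcc_of_le (by linarith)]
      exact fun h => absurd h.1 (not_le.2 he)
    · intro v hv
      have hv0 : 0 < v := he.trans_le hv.1
      refine (Real.rpow_le_rpow dist_nonneg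
        (dist_clampedPower_sub_le ha hV hV1 he hv.1 hv.2) hp.le).trans_eq ?_
      rw [Real.mul_rpow (by positivity) (by positivity), Real.mul_rpow (by positivity) he.le,
        ← Real.rpow_mul hv0.le]

/-- The image of Lebesgue measure on `(0, V]` under the power map. -/
noncomputable def powerMeasure (a V : ℝ) : Measure unitInterval :=
  (volume.restrict (Ioc 0 V)).map (clampedPower a V)

instance : IsFiniteMeasure (powerMeasure a V) := by
  have : IsFiniteMeasure (volume.restrict (Ioc 0 V)) := ⟨by simp⟩
  exact Measure.isFiniteMeasure_map _ _

lemma integral_add_smul_dirac {X : Type*} [PseudoMetricSpace X] [CompactSpace X] [MeasurableSpace X]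
    [BorelSpace X] (φ : C(X, ℝ)) (μ : Measure X) [IsFiniteMeasure μ] (he : 0 ≤ e) (x : X) :
    ∫ z, φ z ∂(μ + ENNReal.ofReal e • Measure.dirac x) = ∫ z, φ z ∂μ + e * φ x := by
  have : IsFiniteMeasure (ENNReal.ofReal e • Measure.dirac x) := Measure.smul_finite _ (by simp)
  rw [integral_add_measure (φ.integrable_of_compact μ) (φ.integrable_of_compact _),
    integral_smul_measure, integral_dirac' _ _ φ.continuous.stronglyMeasurable,
    ENNReal.toReal_ofReal he, smul_eq_mul]

/-- The plan is the image of Lebesgue measure on `(0, V + e)` under `v ↦ (G (v - e), G v)`, with `G`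
the clamped power. Clamping collapses the first `e` units to `0` in one marginal and the last `e`
units to `G V` in the other. -/
lemma dualBound_powerMeasure (ha : 0 < a) (hV : 0 ≤ V) (hV1 : V ≤ 1) (he : 0 < e) (hp : 0 < p) :
    DualBound p (powerMeasure a V + ENNReal.ofReal e • Measure.dirac 0)
      (powerMeasure a V + ENNReal.ofReal e • Measure.dirac (clampedPower a V V))
      (max 1 a ^ p * shiftCost p a V e) := by
  intro φ ψ hφψ
  refine le_trans ?_ (integral_dist_clampedPower_le ha hV hV1 he hp)
  have hG : Continuous (clampedPower a V) := continuous_clampedPower ha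
  have hint (f : C(unitInterval, ℝ)) :
      ∫ z, f z ∂(powerMeasure a V) = ∫ v in (0 : ℝ)..V, f (clampedPower a V v) := by
    rw [powerMeasure, integral_map hG.aemeasurable f.continuous.aestronglyMeasurable,
      intervalIntegral.integral_of_le hV]
  have hφG : Continuous fun v => φ (clampedPower a V v) := φ.continuous.comp hG
  have hψG : Continuous fun v => ψ (clampedPower a V v) := ψ.continuous.comp hG
  have h1 : ∫ v in (0 : ℝ)..(V + e), φ (clampedPower a V (v - e)) =
      (∫ v in (0 : ℝ)..V, φ (clampedPower a V v)) + e * φ 0 := by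
    rw [intervalIntegral.integral_comp_sub_right (fun v => φ (clampedPower a V v)) e,
      add_sub_cancel_right, ← intervalIntegral.integral_add_adjacent_intervals
        (hφG.intervalIntegrable _ 0) (hφG.intervalIntegrable 0 V), add_comm]
    congr 1
    have : ∫ v in (0 - e)..0, φ (clampedPower a V v) = ∫ _ in (0 - e)..0, φ 0 := by
      refine intervalIntegral.integral_congr fun v hv => ?_
      rw [uIcc_of_le (by linarith)] at hv
      simp only [clampedPower_of_nonpos ha hv.2]
    rw [this, intervalIntegral.integral_const, smul_eq_mul]
    ring
  have h2 : ∫ v in (0 : ℝ)..(V + e), ψ (clampedPower a V v) =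
      (∫ v in (0 : ℝ)..V, ψ (clampedPower a V v)) + e * ψ (clampedPower a V V) := by
    rw [← intervalIntegral.integral_add_adjacent_intervals
        (hψG.intervalIntegrable 0 V) (hψG.intervalIntegrable V _)]
    congr 1
    have : ∫ v in V..(V + e), ψ (clampedPower a V v) =
        ∫ _ in V..(V + e), ψ (clampedPower a V V) := by
      refine intervalIntegral.integral_congr fun v hv => ?_
      rw [uIcc_of_le (by linarith)] at hv
      simp only [clampedPower_of_ge hv.1]
    rw [this, intervalIntegral.integral_const, smul_eq_mul]
    ring
  have hφG' : Continuous fun v => φ (clampedPower a V (v - e)) :=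
    hφG.comp (continuous_id.sub continuous_const)
  rw [integral_add_smul_dirac φ _ he.le, integral_add_smul_dirac ψ _ he.le, hint, hint, ← h1, ← h2,
    ← intervalIntegral.integral_add
      (hφG'.intervalIntegrable _ _) (hψG.intervalIntegrable _ _)]
  refine intervalIntegral.integral_mono_on (by linarith) (Continuous.intervalIntegrable ?_ _ _)
    (Continuous.intervalIntegrable ?_ _ _) fun v _ => hφψ _ _
  · exact hφG'.add hψG
  · exact ((hG.comp (continuous_id.sub continuous_const)).dist hG).rpow_const
      fun _ => Or.inr hp.le

/-- The measure `K s ^ (d - 1) (1 - s) ^ (d - 1) ds` on `[0, 1]`. -/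
noncomputable def betaWeight (d K : ℝ) : Measure unitInterval :=
  volume.withDensity fun s =>
    ENNReal.ofReal (K * (s : ℝ) ^ (d - 1) * (1 - (s : ℝ)) ^ (d - 1))

variable {d K : ℝ}

lemma measurable_betaDensity : Measurable fun s : unitInterval =>
    ENNReal.ofReal (K * (s : ℝ) ^ (d - 1) * (1 - (s : ℝ)) ^ (d - 1)) := by fun_prop

lemma map_symm_betaWeight : (betaWeight d K).map unitInterval.symm = betaWeight d K := by
  ext E hE
  rw [Measure.map_apply unitInterval.measurable_symm hE, betaWeight,
    withDensity_apply _ (unitInterval.measurable_symm hE), withDensity_apply _ hE,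
    ← unitInterval.measurePreserving_symm.setLIntegral_comp_preimage hE
      measurable_betaDensity]
  refine lintegral_congr fun s => ?_
  simp only [unitInterval.coe_symm_eq, sub_sub_cancel]
  congr 1
  ring

lemma min_one_le_one_sub_rpow {s : ℝ} (hs : 0 ≤ s) (hs' : s ≤ 1 / 2) :
    min 1 ((1 / 2 : ℝ) ^ (d - 1)) ≤ (1 - s) ^ (d - 1) := by
  rcases le_total 0 (d - 1) with h | h
  · exact (min_le_right _ _).trans (Real.rpow_le_rpow (by norm_num) (by linarith) h)
  · refine (min_le_left _ _).trans ?_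
    exact Real.one_le_rpow_of_pos_of_le_one_of_nonpos (by linarith) (by linarith) h

/-- The substitution `v = s ^ d` gives `powerMeasure` the density `d * s ^ (d - 1)` on `(0, 1 / 2]`,
and there the factor `(1 - s) ^ (d - 1)` is bounded below. -/
lemma smul_powerMeasure_le_betaWeight (hd : 0 < d) (hK : 0 < K) :
    ENNReal.ofReal (K * min 1 ((1 / 2 : ℝ) ^ (d - 1)) / d) •
      powerMeasure (1 / d) ((1 / 2 : ℝ) ^ d) ≤ betaWeight d K := by
  set V : ℝ := (1 / 2 : ℝ) ^ d with hV
  set c := K * min 1 ((1 / 2 : ℝ) ^ (d - 1)) / d with hc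
  have hG := continuous_clampedPower (V := V) (one_div_pos.2 hd)
  have hc0 : 0 ≤ c := by positivity
  have himage : (fun s : ℝ => s ^ d) '' Ioc 0 (1 / 2) = Ioc 0 V := by
    ext v
    constructor
    · rintro ⟨s, hs, rfl⟩
      exact ⟨Real.rpow_pos_of_pos hs.1 d, Real.rpow_le_rpow hs.1.le hs.2 hd.le⟩
    · intro hv
      refine ⟨v ^ (1 / d), ⟨Real.rpow_pos_of_pos hv.1 _, ?_⟩, ?_⟩
      · refine (Real.rpow_le_rpow hv.1.le hv.2 (by positivity)).trans_eq ?_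
        rw [hV, ← Real.rpow_mul (by norm_num), mul_one_div_cancel hd.ne', Real.rpow_one]
      · simp only
        rw [← Real.rpow_mul hv.1.le, one_div_mul_cancel hd.ne', Real.rpow_one]
  refine Measure.le_iff.2 fun E hE => ?_
  let F : ℝ → ℝ≥0∞ := fun s => E.indicator 1 (projIcc (0 : ℝ) 1 zero_le_one s)
  have hL : powerMeasure (1 / d) V E =
      ∫⁻ s in Ioc (0 : ℝ) (1 / 2), ENNReal.ofReal |d * s ^ (d - 1)| * F s := by
    rw [powerMeasure, Measure.map_apply hG.measurable hE, ← lintegral_indicator_one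
      (hG.measurable hE), ← himage, lintegral_image_eq_lintegral_abs_deriv_mul measurableSet_Ioc
      (fun s hs => (Real.hasDerivAt_rpow_const (Or.inl hs.1.ne')).hasDerivWithinAt)
      (fun s hs t ht h => (Real.rpow_left_inj hs.1.le ht.1.le hd.ne').1 h)]
    refine setLIntegral_congr_fun measurableSet_Ioc fun s hs => ?_
    have : clampedPower (1 / d) V (s ^ d) = projIcc (0 : ℝ) 1 zero_le_one s := by
      rw [clampedPower, min_eq_left (Real.rpow_le_rpow hs.1.le hs.2 hd.le),
        max_eq_right (Real.rpow_nonneg hs.1.le d), ← Real.rpow_mul hs.1.le,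
        mul_one_div_cancel hd.ne', Real.rpow_one]
    simp only [F, ← this]
    rfl
  have hR : betaWeight d K E =
      ∫⁻ s in Icc (0 : ℝ) 1, ENNReal.ofReal (K * s ^ (d - 1) * (1 - s) ^ (d - 1)) * F s := by
    rw [betaWeight, withDensity_apply _ hE, ← lintegral_indicator hE, ← lintegral_subtype_comap
      measurableSet_Icc]
    refine lintegral_congr fun s => ?_
    by_cases hs : s ∈ E <;> simp [F, hs]
  rw [Measure.smul_apply, smul_eq_mul, hL, hR, ← lintegral_const_mul' _ _ ENNReal.ofReal_ne_top]
  refine le_trans (setLIntegral_mono' measurableSet_Ioc fun s hs => ?_)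
    (lintegral_mono_set (Ioc_subset_Icc_self.trans (Icc_subset_Icc_right (by norm_num))))
  rw [← mul_assoc, ← ENNReal.ofReal_mul hc0]
  refine mul_le_mul_left (ENNReal.ofReal_le_ofReal ?_) _
  have h1 : 0 ≤ s ^ (d - 1) := Real.rpow_nonneg hs.1.le _
  rw [abs_of_nonneg (by positivity)]
  calc c * (d * s ^ (d - 1)) = K * s ^ (d - 1) * min 1 ((1 / 2 : ℝ) ^ (d - 1)) := by
        rw [hc]; field_simp
    _ ≤ _ := mul_le_mul_of_nonneg_left (min_one_le_one_sub_rpow hs.1.le hs.2) (by positivity)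

lemma DualBound.comp_symm {μ ν : Measure unitInterval} {B : ℝ} (h : DualBound p μ ν B) :
    DualBound p (μ.map unitInterval.symm) (ν.map unitInterval.symm) B := fun φ ψ hφψ => by
  have hs := unitInterval.measurable_symm.aemeasurable (μ := μ)
  have hs' := unitInterval.measurable_symm.aemeasurable (μ := ν)
  rw [integral_map hs φ.continuous.aestronglyMeasurable,
    integral_map hs' ψ.continuous.aestronglyMeasurable]
  refine h (φ.comp ⟨_, unitInterval.continuous_symm⟩) (ψ.comp ⟨_, unitInterval.continuous_symm⟩)
    fun x y => (hφψ _ _).trans_eq ?_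
  change dist (unitInterval.symm x) (unitInterval.symm y) ^ p = _
  rw [Subtype.dist_eq, Subtype.dist_eq, unitInterval.coe_symm_eq, unitInterval.coe_symm_eq,
    dist_sub_left]

/-- Cost of moving a point mass from one end of `[0, 1]` to the other across `betaWeight d K`. -/
lemma exists_dualBound_betaWeight (hd : 0 < d) (hK : 0 < K) (hp : 1 < p) :
    ∃ c C : ℝ, 0 < c ∧ 0 < C ∧ ∀ e, 0 < e → IsFiniteMeasure (betaWeight d K) →
      DualBound p (betaWeight d K + ENNReal.ofReal e • Measure.dirac 0)
        (betaWeight d K + ENNReal.ofReal e • Measure.dirac 1)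
        (C * shiftCost p (1 / d) ((1 / 2 : ℝ) ^ d) (c * e)) := by
  set V : ℝ := (1 / 2 : ℝ) ^ d
  set κ := K * min 1 ((1 / 2 : ℝ) ^ (d - 1)) / d
  have hκ : 0 < κ := by positivity
  have hV1 : V ≤ 1 := Real.rpow_le_one (by norm_num) (by norm_num) hd.le
  have ha : 0 < 1 / d := one_div_pos.2 hd
  set h := clampedPower (1 / d) V V with hh
  -- `h` is the point `1 / 2`, so the path from `0` to `h` and its reflection meet there.
  have hh' : unitInterval.symm h = h := by
    ext
    rw [unitInterval.coe_symm_eq, hh, coe_clampedPower ha hV1, min_self,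
      max_eq_right (by positivity), ← Real.rpow_mul (by norm_num), mul_one_div_cancel hd.ne']
    norm_num
  -- Multiplying the power measure by `κ` turns a point mass `κ⁻¹ * e` into `e`; the factor `2 ^ (p
  -- - 1) * 2` joins the two halves of the interval.
  refine ⟨κ⁻¹, 2 ^ (p - 1) * (2 * (κ * max 1 (1 / d) ^ p)), by positivity, by positivity,
    fun e he _ => ?_⟩
  have hfin (x : unitInterval) : IsFiniteMeasure (ENNReal.ofReal e • Measure.dirac x) :=
    Measure.smul_finite _ (by simp)
  have h1 := (dualBound_powerMeasure ha (by positivity : 0 ≤ V) hV1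
    (by positivity : 0 < κ⁻¹ * e) (by linarith : 0 < p)).smul hκ.le
  rw [smul_add, smul_add, smul_smul, smul_smul, ← ENNReal.ofReal_mul hκ.le,
    mul_inv_cancel_left₀ hκ.ne'] at h1
  have h2 := h1.mono_common (by linarith) (smul_powerMeasure_le_betaWeight hd hK)
  have h3 := h2.comp_symm.symm
  rw [Measure.map_add _ _ unitInterval.measurable_symm,
    Measure.map_add _ _ unitInterval.measurable_symm, map_symm_betaWeight, Measure.map_smul,
    Measure.map_smul, Measure.map_dirac' unitInterval.measurable_symm,
    Measure.map_dirac' unitInterval.measurable_symm, ← hh, hh', unitInterval.symm_zero] at h3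
  refine (h2.trans hp h3).mono (le_of_eq ?_)
  ring

end OneDimensional

/-! ### Transport along tubes and chains of tubes -/

section Tubes

open Set

variable {X : Type*} [MetricSpace X] [MeasurableSpace X]
  {D : Type*} [MeasurableSpace D] {β : Measure D} [IsProbabilityMeasure β]
  {μ : ProbabilityMeasure X} {d K p e t : ℝ} {L : ℝ≥0} {y y' : X} {Φ : unitInterval × D → X}

lemma tubeMeasure_eq_prod : tubeMeasure d K β = (betaWeight d K).prod β := by
  rw [betaWeight, prod_withDensity_left measurable_betaDensity, tubeMeasure]

lemma IsTube.isFiniteMeasure_betaWeight (h : IsTube d L K β μ y y' Φ) :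
    IsFiniteMeasure (betaWeight d K) := by
  refine ⟨?_⟩
  have h1 := h.map_le univ
  rw [Measure.map_apply h.measurable MeasurableSet.univ, preimage_univ, tubeMeasure_eq_prod,
    ← univ_prod_univ, Measure.prod_prod, measure_univ (μ := β), mul_one] at h1
  exact h1.trans_lt (measure_lt_top _ _)

variable [CompactSpace X] [BorelSpace X]

/-- A bound for transport along `[0, 1]` carries over to transport along a tube. -/
lemma IsTube.dualBound (h : IsTube d L K β μ y y' Φ) (hL : 0 < L) (hp : 0 < p) (he : 0 < e)
    (ht : DualBound p (betaWeight d K + ENNReal.ofReal e • Measure.dirac 0)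
      (betaWeight d K + ENNReal.ofReal e • Measure.dirac 1) t) :
    DualBound p ((μ : Measure X) + ENNReal.ofReal e • Measure.dirac y)
      (μ + ENNReal.ofReal e • Measure.dirac y') (L ^ p * t) := by
  have hfin := h.isFiniteMeasure_betaWeight
  intro φ ψ hφψ
  rw [integral_add_smul_dirac φ _ he.le, integral_add_smul_dirac ψ _ he.le]
  -- On the diagonal the cost vanishes, so `φ + ψ ≤ 0`; hence passing from the tube's image measure
  -- to the larger `μ` only lowers the integral.
  have hle : ∫ x, (φ + ψ) x ∂(μ : Measure X) ≤
      ∫ x, (φ + ψ) x ∂((tubeMeasure d K β).map Φ) := by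
    have hneg := integral_mono_measure (f := fun x => -(φ + ψ) x) h.map_le
      (.of_forall fun x => by
        have := hφψ x x
        rw [dist_self, Real.zero_rpow hp.ne'] at this
        simpa using by linarith) ((φ + ψ).integrable_of_compact μ).neg
    simp only [integral_neg] at hneg
    linarith
  -- Each fibre is an `L`-Lipschitz path from `y` to `y'`, so the potentials pulled back to it are
  -- admissible for `L ^ p` times the cost on `[0, 1]`.
  have hfib (b : D) : ∫ s, (φ + ψ) (Φ (s, b)) ∂(betaWeight d K) + e * (φ y + ψ y') ≤ L ^ p * t := by
    have hc : Continuous fun s => Φ (s, b) := (h.lipschitz b).continuous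
    have := ht.scaled (A := (L : ℝ) ^ p) (by positivity) (φ.comp ⟨_, hc⟩) (ψ.comp ⟨_, hc⟩)
      fun s s' => by
        refine (hφψ _ _).trans ?_
        rw [← Real.mul_rpow L.coe_nonneg dist_nonneg]
        exact Real.rpow_le_rpow dist_nonneg ((h.lipschitz b).dist_le_mul s s') hp.le
    rw [integral_add_smul_dirac _ _ he.le, integral_add_smul_dirac _ _ he.le] at this
    simp only [ContinuousMap.comp_apply, ContinuousMap.coe_mk, h.source, h.target] at this
    have hadd : ∫ s, (φ + ψ) (Φ (s, b)) ∂(betaWeight d K) =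
        ∫ s, φ (Φ (s, b)) ∂(betaWeight d K) + ∫ s, ψ (Φ (s, b)) ∂(betaWeight d K) :=
      integral_add ((φ.comp ⟨_, hc⟩).integrable_of_compact _)
        ((ψ.comp ⟨_, hc⟩).integrable_of_compact _)
    linarith
  have hint : Integrable (fun z => (φ + ψ) (Φ z)) ((betaWeight d K).prod β) :=
    Integrable.of_bound ((φ + ψ).continuous.measurable.comp h.measurable).aestronglyMeasurable
      ‖φ + ψ‖ (.of_forall fun z => (φ + ψ).norm_coe_le_norm _)
  have htube : ∫ x, (φ + ψ) x ∂((tubeMeasure d K β).map Φ) ≤ L ^ p * t - e * (φ y + ψ y') := by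
    rw [integral_map h.measurable.aemeasurable (φ + ψ).continuous.aestronglyMeasurable,
      tubeMeasure_eq_prod, integral_prod_symm _ hint]
    have := integral_mono hint.integral_prod_right
      (integrable_const (μ := β) (L ^ p * t - e * (φ y + ψ y')))
      fun b => le_sub_iff_add_le.2 (hfib b)
    simpa using this
  have hadd : ∫ x, (φ + ψ) x ∂(μ : Measure X) = ∫ x, φ x ∂(μ : Measure X) + ∫ x, ψ x ∂(μ : Measure X) :=
    integral_add (φ.integrable_of_compact _) (ψ.integrable_of_compact _)
  linarith

lemma DualBound.chain [Nonempty X] (hp : 1 < p) (ht : 0 ≤ t) (n : ℕ) (ν : Fin (n + 1) → Measure X)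
    [∀ j, IsFiniteMeasure (ν j)]
    (h : ∀ j : Fin n, DualBound p (ν j.castSucc) (ν j.succ) t) :
    DualBound p (ν 0) (ν (Fin.last n)) ((2 ^ (p - 1) * 2) ^ n * t) := by
  induction n with
  | zero => exact (DualBound.refl (by linarith) (ν 0)).mono (by simpa using ht)
  | succ n ih =>
    have h1 := ih (fun j => ν j.castSucc) fun j => by
      simpa only [Fin.succ_castSucc] using h j.castSucc
    have h2 := h (Fin.last n)
    refine (h1.trans hp h2).mono ?_
    have hge : 1 ≤ (2 ^ (p - 1) * 2 : ℝ) ^ n := by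
      refine one_le_pow₀ ?_
      have : 1 ≤ (2 : ℝ) ^ (p - 1) := Real.one_le_rpow (by norm_num) (by linarith)
      linarith
    have : 0 < (2 : ℝ) ^ (p - 1) := by positivity
    rw [pow_succ, mul_comm (_ ^ n) (2 ^ (p - 1) * 2 : ℝ), mul_assoc, mul_assoc]
    refine mul_le_mul_of_nonneg_left ?_ this.le
    nlinarith

end Tubes

/-! ### Moving a point mass within a strongly connected measure -/

section Connected

variable {X : Type*} [MetricSpace X] [CompactSpace X] [MeasurableSpace X] [BorelSpace X]
  {d K p : ℝ} {L : ℝ≥0} {N : ℕ}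

/-- In a strongly connected measure, a point mass can be moved between any two points of the
support at the cost of `shiftCost`. -/
lemma exists_dualBound_of_stronglyConnected (hd : 0 < d) (hK : 0 < K) (hL : 0 < L) (hp : 1 < p) :
    ∃ c C : ℝ, 0 < c ∧ 0 < C ∧ ∀ μ : ProbabilityMeasure X,
      StronglyConnectedWith.{v} d L K N μ → ∀ e, 0 < e → ∀ x₀ ∈ supp μ, ∀ x₁ ∈ supp μ,
        DualBound p ((μ : Measure X) + ENNReal.ofReal e • Measure.dirac x₀)
          (μ + ENNReal.ofReal e • Measure.dirac x₁)
          (C * shiftCost p (1 / d) ((1 / 2 : ℝ) ^ d) (c * e)) := by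
  obtain ⟨c, C, hc, hC, h⟩ := exists_dualBound_betaWeight hd hK hp
  refine ⟨c, (2 ^ (p - 1) * 2) ^ N * (L ^ p * C), hc, by positivity, ?_⟩
  rintro μ ⟨D, _, β, hβ, hconn⟩ e he x₀ hx₀ x₁ hx₁
  obtain ⟨n, y, Φ, hn, rfl, rfl, -, hΦ⟩ := hconn x₀ hx₀ x₁ hx₁
  have : Nonempty X := ⟨y 0⟩
  have hfin (x : X) : IsFiniteMeasure (ENNReal.ofReal e • Measure.dirac x) :=
    Measure.smul_finite _ (by simp)
  set R := shiftCost p (1 / d) ((1 / 2 : ℝ) ^ d) (c * e) with hR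
  have hR0 : 0 ≤ R := by
    have hce : 0 < c * e := by positivity
    have hV : 0 < (1 / 2 : ℝ) ^ d := by positivity
    refine add_nonneg (by positivity) (mul_nonneg (by positivity)
      (intervalIntegral.integral_nonneg (by linarith) fun v hv => ?_))
    exact Real.rpow_nonneg (hce.le.trans hv.1) _
  have hstep (j : Fin n) := (hΦ j).dualBound hL (by linarith) he
    (h e he (hΦ j).isFiniteMeasure_betaWeight)
  have := DualBound.chain hp (t := L ^ p * (C * R)) (by positivity) n
    (fun j => (μ : Measure X) + ENNReal.ofReal e • Measure.dirac (y j)) hstep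
  refine this.mono ?_
  have h2 : 1 ≤ (2 ^ (p - 1) * 2 : ℝ) := by
    have : 1 ≤ (2 : ℝ) ^ (p - 1) := Real.one_le_rpow (by norm_num) (by linarith)
    linarith
  have h3 := pow_le_pow_right₀ h2 (by omega : n ≤ N)
  calc (2 ^ (p - 1) * 2) ^ n * (L ^ p * (C * R))
      ≤ (2 ^ (p - 1) * 2) ^ N * (L ^ p * (C * R)) := by gcongr
    _ = _ := by ring

end Connected

/-! ### Total variation and the two truncated differences -/

section TotalVariation

variable {X : Type*} [MeasurableSpace X]

lemma add_sub_eq_add_sub_measure (μ ν : Measure X) [IsFiniteMeasure μ] [IsFiniteMeasure ν] :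
    μ + (ν - μ) = ν + (μ - ν) := by
  rw [← Measure.toSignedMeasure_eq_toSignedMeasure_iff, Measure.toSignedMeasure_add,
    Measure.toSignedMeasure_add, add_comm ν.toSignedMeasure, ← sub_eq_sub_iff_add_eq_add]
  exact Measure.sub_toSignedMeasure_eq_toSignedMeasure_sub

lemma tvDist_eq (μ ν : ProbabilityMeasure X) :
    tvDist μ ν = ((μ : Measure X) - ν).real Set.univ + ((ν : Measure X) - μ).real Set.univ := by
  rw [tvDist, SignedMeasure.totalVariation, Measure.toJordanDecomposition_toSignedMeasure_sub]
  exact ENNReal.toReal_add (measure_ne_top _ _) (measure_ne_top _ _)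

lemma real_sub_univ_comm (μ ν : ProbabilityMeasure X) :
    ((μ : Measure X) - ν).real Set.univ = ((ν : Measure X) - μ).real Set.univ := by
  have h := congrArg (fun ρ : Measure X => ρ.real Set.univ)
    (add_sub_eq_add_sub_measure (μ : Measure X) ν)
  rw [measureReal_add_apply, measureReal_add_apply, probReal_univ (μ := (μ : Measure X)),
    probReal_univ (μ := (ν : Measure X))] at h
  linarith

end TotalVariation

/-! ### From moving point masses to reaching the midpoint -/

section Midpoint

variable {X : Type*} [MetricSpace X] [CompactSpace X] [MeasurableSpace X] [BorelSpace X]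

lemma integral_le_of_forall_mem {ρ : Measure X} [IsFiniteMeasure ρ] (φ : C(X, ℝ)) {S : Set X}
    (hS : S ∈ ae ρ) {M : ℝ} (hM : ∀ x ∈ S, φ x ≤ M) : ∫ x, φ x ∂ρ ≤ ρ.real Set.univ * M := by
  have := integral_mono_ae (φ.integrable_of_compact ρ) (integrable_const M)
    (Filter.mem_of_superset hS hM)
  simpa using this

/-- With `P` the excess and `Q` the deficit, the dual value is `∫ (φ + ψ) dμ + (∫ ψ dQ - ∫ ψ dP) /
2`. One half of the first term, by `φ + ψ ≤ 0` and `P ≤ μ`, trades `-∫ ψ dP` for `∫ φ dP`; the other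
half is the background for the point-mass bound `h`. -/
lemma dualBound_midpoint {p e t : ℝ} (hp : 0 < p) {μ ν : ProbabilityMeasure X}
    (hsupp : supp ν ⊆ supp μ) (hle : tvDist ν μ ≤ e) (ht : 0 ≤ t) (he : 0 ≤ e)
    (h : ∀ x₀ ∈ supp μ, ∀ x₁ ∈ supp μ,
      DualBound p ((μ : Measure X) + ENNReal.ofReal e • Measure.dirac x₀)
        (μ + ENNReal.ofReal e • Measure.dirac x₁) t) :
    DualBound p (μ : Measure X) (ENNReal.ofReal (1 / 2) • ((μ : Measure X) + ν)) t := by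
  intro φ ψ hφψ
  set P := (μ : Measure X) - ν with hP
  set Q := (ν : Measure X) - μ with hQ
  have hcompact : IsCompact (supp μ) := Measure.isClosed_support.isCompact
  have hne : (supp μ).Nonempty := Measure.nonempty_support (NeZero.ne _)
  obtain ⟨x₀, hx₀, hmax₀⟩ := hcompact.exists_isMaxOn hne φ.continuous.continuousOn
  obtain ⟨x₁, hx₁, hmax₁⟩ := hcompact.exists_isMaxOn hne ψ.continuous.continuousOn
  have hPμ : P ≤ μ := Measure.sub_le
  have hQν : Q ≤ ν := Measure.sub_le
  have hφP : ∫ x, φ x ∂P ≤ P.real Set.univ * φ x₀ :=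
    integral_le_of_forall_mem φ (hPμ.absolutelyContinuous.ae_le Measure.support_mem_ae) hmax₀
  -- The inclusion of supports places `Q`, a part of `ν`, on `supp μ`, where `ψ` is maximal at `x₁`.
  have hψQ : ∫ x, ψ x ∂Q ≤ P.real Set.univ * ψ x₁ := by
    rw [hP, real_sub_univ_comm]
    exact integral_le_of_forall_mem ψ (Filter.mem_of_superset
      (hQν.absolutelyContinuous.ae_le Measure.support_mem_ae) hsupp) hmax₁
  have hmass : P.real Set.univ ≤ e := by
    rw [tvDist_eq, real_sub_univ_comm] at hle
    have : 0 ≤ P.real Set.univ := measureReal_nonneg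
    linarith
  have hswap : ∫ x, ψ x ∂(μ : Measure X) + ∫ x, ψ x ∂Q =
      ∫ x, ψ x ∂(ν : Measure X) + ∫ x, ψ x ∂P := by
    have := congrArg (fun ρ => ∫ x, ψ x ∂ρ) (add_sub_eq_add_sub_measure (μ : Measure X) ν)
    simpa only [integral_add_measure (ψ.integrable_of_compact _) (ψ.integrable_of_compact _)]
      using this
  have hnonpos (x : X) : φ x + ψ x ≤ 0 := by
    simpa [Real.zero_rpow hp.ne'] using hφψ x x
  have hcommon : ∫ x, φ x ∂(μ : Measure X) + ∫ x, ψ x ∂(μ : Measure X) ≤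
      ∫ x, φ x ∂P + ∫ x, ψ x ∂P := by
    rw [← integral_add (φ.integrable_of_compact _) (ψ.integrable_of_compact _),
      ← integral_add (φ.integrable_of_compact _) (ψ.integrable_of_compact _)]
    have hneg := integral_mono_measure (f := fun x => -(φ x + ψ x)) hPμ
      (.of_forall fun x => neg_nonneg.2 (hnonpos x)) ((φ + ψ).integrable_of_compact μ).neg
    simp only [integral_neg] at hneg
    linarith
  have hμ : ∫ x, φ x ∂(μ : Measure X) + ∫ x, ψ x ∂(μ : Measure X) ≤ 0 :=
    DualBound.refl hp (μ : Measure X) φ ψ hφψ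
  have hmove := h x₀ hx₀ x₁ hx₁ φ ψ hφψ
  rw [integral_add_smul_dirac φ _ he, integral_add_smul_dirac ψ _ he] at hmove
  rw [integral_smul_measure, integral_add_measure (ψ.integrable_of_compact _)
    (ψ.integrable_of_compact _), ENNReal.toReal_ofReal (by norm_num), smul_eq_mul]
  have hm0 : 0 ≤ P.real Set.univ := measureReal_nonneg
  -- If the sum of maxima is non-positive, the value is at most `0`. Otherwise the mass of `P` may
  -- be raised to `e`, and half of `hmove` applies.
  rcases le_total (φ x₀ + ψ x₁) 0 with hs | hs
  · nlinarith
  · nlinarith [mul_le_mul_of_nonneg_right hmass hs]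

end Midpoint

/-! ### Asymptotics of the shift cost -/

section Rates

variable {p a V M : ℝ}

lemma exponent_eq {d : ℝ} (hp : 1 < p) :
    p * min 1 (1 / d + 1 / p) = min p (1 + 1 / d * p) := by
  rw [mul_min_of_nonneg _ _ (by linarith : 0 ≤ p), mul_one]
  congr 1
  field_simp
  ring

lemma notMem_uIcc_zero {e : ℝ} (hV : 0 ≤ V) (he : 0 < e) : (0 : ℝ) ∉ Set.uIcc e (V + e) := by
  rw [Set.uIcc_of_le (by linarith)]
  exact fun h => absurd h.1 (not_le.2 he)

lemma exists_shiftCost_le_rpow (hV : 0 ≤ V) (hM : 0 < M)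
    (hne : (a - 1) * p ≠ -1) :
    ∃ C : ℝ, 0 < C ∧ ∀ x : ℝ, 0 < x → x ≤ 1 →
      shiftCost p a V (M * x) ≤ C * x ^ min p (1 + a * p) := by
  set b := (a - 1) * p with hb
  have hab : 1 + a * p = p + (b + 1) := by rw [hb]; ring
  rcases lt_or_gt_of_ne hne with h | h
  · have hb1 : 0 < -(b + 1) := by linarith
    refine ⟨M ^ (1 + a * p) * (1 + 1 / -(b + 1)), by positivity, fun x hx _ => ?_⟩
    have he : 0 < M * x := by positivity
    rw [min_eq_right (by linarith), shiftCost, ← hb,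
      integral_rpow (Or.inr ⟨hne, notMem_uIcc_zero hV he⟩)]
    have h1 : ((V + M * x) ^ (b + 1) - (M * x) ^ (b + 1)) / (b + 1) ≤
        (M * x) ^ (b + 1) * (1 / -(b + 1)) := by
      rw [← neg_div_neg_eq, div_eq_mul_one_div]
      refine mul_le_mul_of_nonneg_right ?_ (by positivity)
      have : 0 ≤ (V + M * x) ^ (b + 1) := by positivity
      linarith
    calc _ ≤ (M * x) ^ (1 + a * p) + (M * x) ^ p * ((M * x) ^ (b + 1) * (1 / -(b + 1))) := by gcongr
      _ = _ := by
        rw [← mul_assoc, ← Real.rpow_add he, ← hab, Real.mul_rpow hM.le hx.le]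
        ring
  · have hb1 : 0 < b + 1 := by linarith
    refine ⟨M ^ (1 + a * p) + M ^ p * ((V + M) ^ (b + 1) / (b + 1)), by positivity,
      fun x hx hx1 => ?_⟩
    have he : 0 < M * x := by positivity
    rw [min_eq_left (by linarith), shiftCost, ← hb, integral_rpow (Or.inl h)]
    have h1 : ((V + M * x) ^ (b + 1) - (M * x) ^ (b + 1)) / (b + 1) ≤
        (V + M) ^ (b + 1) / (b + 1) := by
      refine div_le_div_of_nonneg_right ?_ hb1.le
      have h2 : 0 ≤ (M * x) ^ (b + 1) := by positivity
      have h3 : (V + M * x) ^ (b + 1) ≤ (V + M) ^ (b + 1) :=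
        Real.rpow_le_rpow (by positivity) (by nlinarith) hb1.le
      linarith
    have h4 : x ^ (1 + a * p) ≤ x ^ p := Real.rpow_le_rpow_of_exponent_ge hx hx1 (by linarith)
    calc _ ≤ M ^ (1 + a * p) * x ^ p + (M * x) ^ p * ((V + M) ^ (b + 1) / (b + 1)) := by
          rw [Real.mul_rpow hM.le hx.le (z := 1 + a * p)]
          gcongr
      _ = _ := by
        rw [Real.mul_rpow hM.le hx.le]
        ring

lemma exists_shiftCost_le_log (hV : 0 ≤ V) (hM : 0 < M) (heq : (a - 1) * p = -1) :
    ∃ C : ℝ, 0 < C ∧ ∀ x : ℝ, 0 < x → x ≤ 1 →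
      shiftCost p a V (M * x) ≤ C * (x ^ p * (Real.log (1 / x) + 1)) := by
  have hab : 1 + a * p = p := by linarith
  have hlog : 0 ≤ Real.log ((V + M) / M) :=
    Real.log_nonneg ((one_le_div hM).2 (by linarith))
  refine ⟨M ^ p * (2 + Real.log ((V + M) / M)), by positivity, fun x hx hx1 => ?_⟩
  have he : 0 < M * x := by positivity
  have hint : ∫ v in (M * x)..(V + M * x), v ^ ((a - 1) * p) ≤
      Real.log ((V + M) / M) + Real.log (1 / x) := by
    rw [heq]
    simp_rw [Real.rpow_neg_one]
    rw [integral_inv (notMem_uIcc_zero hV he), ← Real.log_mul (by positivity) (by positivity)]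
    refine Real.log_le_log (by positivity) ?_
    rw [div_mul_div_comm, mul_one]
    exact div_le_div_of_nonneg_right (by nlinarith) he.le
  have hx' : 0 ≤ Real.log (1 / x) := Real.log_nonneg ((one_le_div hx).2 hx1)
  rw [shiftCost, hab, Real.mul_rpow hM.le hx.le]
  have hMx : 0 ≤ M ^ p * x ^ p := by positivity
  calc _ ≤ M ^ p * x ^ p + M ^ p * x ^ p * (Real.log ((V + M) / M) + Real.log (1 / x)) := by gcongr
    _ = M ^ p * x ^ p * (1 + Real.log ((V + M) / M) + Real.log (1 / x)) := by ring
    _ ≤ M ^ p * x ^ p * ((2 + Real.log ((V + M) / M)) * (Real.log (1 / x) + 1)) := by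
        gcongr
        nlinarith
    _ = _ := by ring

end Rates

/-! ### From the curve's total variation to transport bounds -/

section Curves

variable {X : Type*} [MeasurableSpace X] {I : Set ℝ} {r : ℝ≥0∞}

lemma one_sub_toReal_inv_pos (hr : 1 < r) : 0 < 1 - (r⁻¹).toReal := by
  have h : r⁻¹ < 1 := ENNReal.inv_lt_one.2 hr
  have := (ENNReal.toReal_lt_toReal h.ne_top ENNReal.one_ne_top).2 h
  simpa using this

/-- Hölder's inequality on `(τ, t]`, which lies in `I` because `I` is an interval. The `1` added to
the norm of `m` keeps the constant positive. -/
lemma IsACTV.exists_tvDist_le (hI : I.OrdConnected) (hr : 1 < r) {μ : I → ProbabilityMeasure X}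
    (hμ : IsACTV I r μ) :
    ∃ M : ℝ, 0 < M ∧ ∀ τ t : I, τ < t →
      tvDist (μ t) (μ τ) ≤ M * ((t : ℝ) - τ) ^ (1 - (r⁻¹).toReal) := by
  obtain ⟨m, hm0, hm, hle⟩ := hμ
  refine ⟨(eLpNorm m r (volume.restrict I)).toReal + 1, by positivity, fun τ t hτt => ?_⟩
  have hlt : (τ : ℝ) < t := hτt
  refine (hle τ t hτt).trans ?_
  rw [intervalIntegral.integral_of_le hlt.le]
  set J := Set.Ioc (τ : ℝ) t
  have hJI : J ⊆ I := Set.Ioc_subset_Icc_self.trans (hI.out τ.2 t.2)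
  have hmJ : MemLp m r (volume.restrict J) := hm.mono_measure (Measure.restrict_mono_set _ hJI)
  have hθ := one_sub_toReal_inv_pos hr
  have h1 : ENNReal.ofReal (∫ s in J, m s) ≤ eLpNorm m 1 (volume.restrict J) := by
    rw [eLpNorm_one_eq_lintegral_enorm]
    refine (ENNReal.ofReal_le_ofReal (le_abs_self _)).trans ?_
    rw [← Real.enorm_eq_ofReal_abs]
    exact enorm_integral_le_lintegral_enorm _
  have h2 := eLpNorm_le_eLpNorm_mul_rpow_measure_univ hr.le hmJ.aestronglyMeasurable
  have h3 : (volume.restrict J) Set.univ = ENNReal.ofReal ((t : ℝ) - τ) := by simp [J]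
  rw [h3, ENNReal.toReal_one, div_one, one_div, ← ENNReal.toReal_inv,
    ENNReal.ofReal_rpow_of_pos (by linarith)] at h2
  have h4 : eLpNorm m r (volume.restrict J) ≤
      ENNReal.ofReal ((eLpNorm m r (volume.restrict I)).toReal + 1) := by
    refine (eLpNorm_mono_measure m (Measure.restrict_mono_set _ hJI)).trans ?_
    conv_lhs => rw [← ENNReal.ofReal_toReal hm.eLpNorm_ne_top]
    exact ENNReal.ofReal_le_ofReal (by linarith)
  have h5 := h1.trans (h2.trans (mul_le_mul_left h4 _))
  rw [← ENNReal.ofReal_mul (by positivity)] at h5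
  refine (ENNReal.ofReal_le_ofReal_iff ?_).1 h5
  have : 0 ≤ (t : ℝ) - τ := by linarith
  positivity

variable [MetricSpace X] [CompactSpace X] [BorelSpace X]

lemma wasserstein_self {p : ℝ} (hp : 0 < p) (μ : ProbabilityMeasure X) :
    wasserstein p μ μ = 0 := by
  have := (DualBound.refl hp (μ : Measure X)).wasserstein_le hp
  rw [Real.zero_rpow (by positivity)] at this
  simpa using this

lemma wasserstein_le_diam {p : ℝ} (hp : 0 < p) (μ ν : ProbabilityMeasure X) :
    wasserstein p μ ν ≤ ENNReal.ofReal (Metric.diam (Set.univ : Set X)) := by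
  refine (DualBound.of_diam (μ := (μ : Measure X)) (ν := ν) hp).wasserstein_le hp |>.trans_eq ?_
  rw [← Real.rpow_mul Metric.diam_nonneg, mul_one_div_cancel hp.ne', Real.rpow_one]

/-- Estimates for close times extend to all times by compactness. -/
lemma exists_wasserstein_le_of_close {p C : ℝ} (hp : 0 < p) {μ : I → ProbabilityMeasure X}
    (F : ℝ → ℝ) (hF : ∀ g, 1 ≤ g → 1 ≤ F g) (hF0 : ∀ g, 0 < g → 0 ≤ F g) (hC : 0 < C)
    (h : ∀ τ t : I, τ < t → (t : ℝ) - τ ≤ 1 → ∃ B, DualBound p (μ τ : Measure X) (μ t) B ∧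
      B ^ (1 / p) ≤ C * F (t - τ)) :
    ∃ C : ℝ, 0 < C ∧ ∀ t τ : I,
      wasserstein p (μ t) (μ τ) ≤ ENNReal.ofReal (C * F |(t : ℝ) - τ|) := by
  have hdiam : 0 ≤ Metric.diam (Set.univ : Set X) := Metric.diam_nonneg
  refine ⟨C + Metric.diam (Set.univ : Set X), by positivity, fun t τ => ?_⟩
  rcases eq_or_ne t τ with rfl | hne
  · rw [wasserstein_self hp]
    exact zero_le
  have hg : 0 < |(t : ℝ) - τ| := abs_pos.2 (sub_ne_zero.2 fun e => hne (Subtype.ext e))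
  rcases le_total 1 |(t : ℝ) - τ| with h1 | h1
  · refine (wasserstein_le_diam hp _ _).trans (ENNReal.ofReal_le_ofReal ?_)
    nlinarith [hF _ h1]
  · have hmono : C * F |(t : ℝ) - τ| ≤
        (C + Metric.diam (Set.univ : Set X)) * F |(t : ℝ) - τ| :=
      mul_le_mul_of_nonneg_right (by linarith) (hF0 _ hg)
    refine le_trans ?_ (ENNReal.ofReal_le_ofReal hmono)
    rcases lt_or_gt_of_ne hne with hlt | hlt
    · have hlt' : (t : ℝ) < τ := hlt
      rw [abs_sub_comm, abs_of_pos (by linarith)] at h1 ⊢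
      obtain ⟨B, hB, hle⟩ := h t τ hlt h1
      exact (hB.wasserstein_le hp).trans (ENNReal.ofReal_le_ofReal hle)
    · have hlt' : (τ : ℝ) < t := hlt
      rw [abs_of_pos (by linarith)] at h1 ⊢
      obtain ⟨B, hB, hle⟩ := h τ t hlt h1
      exact (hB.symm.wasserstein_le hp).trans (ENNReal.ofReal_le_ofReal hle)

/-- The transport cost between two members of the curve is controlled by `shiftCost`. -/
lemma exists_dualBound_curve {p d : ℝ} (hp : 1 < p) (hd : 0 < d) (hI : I.OrdConnected)
    (hr : 1 < r) {μ : I → ProbabilityMeasure X} (hAC : IsACTV I r μ)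
    (hsupp : ∀ τ t : I, τ < t → supp (μ t) ⊆ supp (μ τ))
    (hconn : UniformlyStronglyConnected.{v} d μ) :
    ∃ M C : ℝ, 0 < M ∧ 0 < C ∧ ∀ τ t : I, τ < t →
      DualBound p (μ τ : Measure X) (μ t) (C * shiftCost p (1 / d) ((1 / 2 : ℝ) ^ d)
        (M * ((t : ℝ) - τ) ^ (1 - (r⁻¹).toReal))) := by
  obtain ⟨L, K, N, hL, hK, -, hconn⟩ := hconn
  obtain ⟨M, hM, htv⟩ := hAC.exists_tvDist_le hI hr
  obtain ⟨c, C, hc, hC, hmove⟩ :=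
    exists_dualBound_of_stronglyConnected (X := X) (N := N) hd hK hL hp
  obtain ⟨A, hA, hAX⟩ := exists_dist_rpow_le X hp
  refine ⟨c * M, 4 * A * C, by positivity, by positivity, fun τ t hτt => ?_⟩
  have hg : 0 < (t : ℝ) - τ := sub_pos.2 hτt
  have he : 0 < M * ((t : ℝ) - τ) ^ (1 - (r⁻¹).toReal) := by positivity
  have hbound := hmove (μ τ) (hconn τ) _ he
  obtain ⟨x, hx⟩ : (supp (μ τ)).Nonempty := Measure.nonempty_support (NeZero.ne _)
  have hmid := dualBound_midpoint (by linarith) (hsupp τ t hτt) (htv τ t hτt)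
    (hbound x hx x hx).nonneg he.le hbound
  refine (hmid.of_midpoint hp hA hAX).mono (le_of_eq ?_)
  rw [mul_assoc c, mul_assoc (4 * A)]

end Curves

/-! ### Conclusion in the regular and critical cases -/

theorem theorem2 {k : ℕ} {Ω : Set (EuclideanSpace ℝ (Fin k))} (hΩ : IsCompact Ω)
    {I : Set ℝ} (hI : I.OrdConnected) {r : ℝ≥0∞} (hr : 1 < r) {d : ℝ} (hd : 0 < d)
    (μ : I → ProbabilityMeasure Ω) (hAC : IsACTV I r μ)
    (hsupp : ∀ τ t : I, τ < t → supp (μ t) ⊆ supp (μ τ))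
    (hconn : UniformlyStronglyConnected.{v} d μ) :
    (∀ p : ℝ, 1 < p → p / (p - 1) ≠ d →
      ∃ C : ℝ, 0 < C ∧ ∀ t τ : I, wasserstein p (μ t) (μ τ) ≤
        ENNReal.ofReal (C * |(t : ℝ) - τ| ^ (min 1 (1 / d + 1 / p) * (1 - (r⁻¹).toReal)))) ∧
    (r = ∞ → ∀ p : ℝ, 1 < p → p / (p - 1) = d →
      ∃ C : ℝ, 0 < C ∧ ∀ t τ : I, wasserstein p (μ t) (μ τ) ≤
        ENNReal.ofReal (C * |(t : ℝ) - τ| *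
          (Real.posLog (1 / |(t : ℝ) - τ|) ^ (1 / p) + 1))) := by
  have : CompactSpace Ω := isCompact_iff_compactSpace.1 hΩ
  have hcrit {p : ℝ} (hp : 1 < p) : p / (p - 1) = d ↔ (1 / d - 1) * p = -1 := by
    have : p - 1 ≠ 0 := by linarith
    rw [div_eq_iff this]
    field_simp
    constructor <;> intro h <;> linarith
  have hV : 0 ≤ (1 / 2 : ℝ) ^ d := by positivity
  refine ⟨fun p hp hne => ?_, ?_⟩
  · have hp0 : 0 < p := by linarith
    obtain ⟨M, C, hM, hC, hcurve⟩ := exists_dualBound_curve hp hd hI hr hAC hsupp hconn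
    obtain ⟨C', hC', hcost⟩ := exists_shiftCost_le_rpow hV hM (mt (hcrit hp).2 hne)
    have hθ := one_sub_toReal_inv_pos hr
    set θ := 1 - (r⁻¹).toReal
    have hq : 0 < min 1 (1 / d + 1 / p) := by positivity
    refine exists_wasserstein_le_of_close hp0
      (fun g => g ^ (min 1 (1 / d + 1 / p) * θ)) (fun g hg => Real.one_le_rpow hg (by positivity))
      (fun g hg => by positivity) (C := (C * C') ^ (1 / p)) (by positivity) fun τ t hτt h1 => ?_
    have hg : 0 < (t : ℝ) - τ := sub_pos.2 hτt
    refine ⟨_, (hcurve τ t hτt).mono (mul_le_mul_of_nonneg_left (hcost _ (by positivity)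
      (Real.rpow_le_one hg.le h1 hθ.le)) hC.le), le_of_eq ?_⟩
    rw [← mul_assoc, Real.mul_rpow (by positivity) (by positivity), ← exponent_eq hp,
      ← Real.rpow_mul (by positivity), ← Real.rpow_mul hg.le]
    congr 2
    field_simp
  · rintro rfl p hp heq
    have hp0 : 0 < p := by linarith
    obtain ⟨M, C, hM, hC, hcurve⟩ := exists_dualBound_curve hp hd hI hr hAC hsupp hconn
    obtain ⟨C', hC', hcost⟩ := exists_shiftCost_le_log hV hM ((hcrit hp).1 heq)
    simp only [ENNReal.inv_top, ENNReal.toReal_zero, sub_zero, Real.rpow_one] at hcurve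
    have hlog (g : ℝ) : 0 ≤ Real.posLog (1 / g) ^ (1 / p) := Real.rpow_nonneg Real.posLog_nonneg _
    simp only [mul_assoc]
    refine exists_wasserstein_le_of_close hp0
      (fun g => g * (Real.posLog (1 / g) ^ (1 / p) + 1)) (fun g hg => by nlinarith [hlog g])
      (fun g hg => mul_nonneg hg.le (by linarith [hlog g])) (C := (C * C') ^ (1 / p))
      (by positivity) fun τ t hτt h1 => ?_
    have hg : 0 < (t : ℝ) - τ := sub_pos.2 hτt
    refine ⟨_, (hcurve τ t hτt).mono (mul_le_mul_of_nonneg_left (hcost _ hg h1) hC.le), ?_⟩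
    have hle : 1 ≤ 1 / ((t : ℝ) - τ) := (one_le_div hg).2 h1
    have hlog0 : 0 ≤ Real.log (1 / ((t : ℝ) - τ)) := Real.log_nonneg hle
    rw [← mul_assoc, Real.mul_rpow (by positivity) (by positivity),
      Real.mul_rpow (x := ((t : ℝ) - τ) ^ p) (by positivity) (by positivity),
      ← Real.rpow_mul hg.le, mul_one_div_cancel hp0.ne', Real.rpow_one,
      Real.posLog_eq_log (by rwa [abs_of_pos (by positivity)])]
    gcongr
    -- Since `1 / p ≤ 1`, the power is subadditive, so `(log + 1) ^ (1 / p) ≤ log ^ (1 / p) + 1`.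
    have := Real.rpow_add_le_add_rpow hlog0 zero_le_one (by positivity : 0 ≤ 1 / p)
      ((div_le_one hp0).2 hp.le)
    simpa using this
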